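/- Let $u,s,k_u,k_s,m\ge 1$ be integers with $k_u<u$ and $k_s\le s$, put $n=us$, and let $\sigma>0$ and $\operatorname{SNR}:=1/\sigma^2$. Write a vector $x\in\mathbb{C}^{us}$ as $u$ blocks $x_1,\dots,x_u\in\mathbb{C}^s$ (one per user); for $\omega\subseteq\{1,\dots,s\}$ let $(x_i)_\omega$ be the restriction of $x_i$ to $\omega$. Call $x$ $(k_u,k_s)$-sparse if at most $k_u$ of its blocks are non-zero and every block has at most $k_s$ non-zero entries. All norms are Euclidean. Random model. A uniformly random set $\mathcal{A}^B$ of exactly $k_u$ users is active, and each user $i$ has a uniformly random set $\mathcal{A}_i$ of exactly $k_s$ tap positions. The channel $h\in\mathbb{C}^{us}$ has i.i.d. $\mathcal{CN}(0,1)$ entries at the positions $\mathcal{A}_i$ of the active users $i$ and is zero elsewhere. The noise is $z'\sim\mathcal{CN}(0,\tfrac{\sigma^2 m}{n^2}I_n)$. The matrix $A\in\mathbb{C}^{m\times n}$ is a subsampled FFT normalized by $\sqrt{n/m}$: its rows are $m$ rows, with (possibly random) indices $b_1,\dots,b_m$ of arbitrary joint law, of $\sqrt{n/m}\,W$, where $W_{kl}=n^{-1/2}e^{-2\pi\imath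 kl/n}$, $0\le k,l<n$. The active set, the tap sets, the channel coefficients, the noise and the row indices are independent. One observes $y=A(h+z')$. Detector (first linear step of HiHTP/HiIHT). Let $x=A^Hy$, let $S$ be the support of a best $(k_u,k_s)$-sparse approximation of $x$ in the Euclidean norm (ties broken by any fixed rule), and let $\hbar$ be equal to $x$ on $S$ and zero elsewhere. For a threshold $\xi\ge 0$, user $i$ is detected if $S$ meets block $i$ and $\|\hbar_i\|\ge\sqrt{\xi}$. Define - $P_{\mathrm{md}}(\xi)$, the probability that user $i$ is not detected, conditionally on user $i$ being active; - $F^z(x)$, the probability that $\|(h_i+z'_i)_{\mathcal{A}_i}\|^2\le x$, conditionally on user $i$ being active; - $\mathbb{P}_{\overline{\mathrm{sRIP}}}(\epsilon)$, the probability that $$\max_{i,\ |\omega|=k_s}\Bigl|\,\|((h+z')_i)_\omega\|^2-\|((A^Hy)_i)_\omega\|^2\Bigr|>\epsilon,$$ where the maximum is over all users $i$ and all $\omega\subseteq\{1,\dots,s\}$ with $|\omega|=k_s$. Then for every user $i$, every $\xi\ge0$ and every $\epsilon>0$, $$P_{\mathrm{md}}(\xi)\le \mathbb{P}_{\overline{\mathrm{sRIP}}}(\epsilon)+2s(u-k_u)\,F^z(\xi+4\epsilon)+n^{-k_s}\operatorname{SNR}^{-k_s}\Bigl(\frac{us}{2k_sm}\Bigr)^{-k_s}s(u-k_u).$$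 -/

import Mathlib

open scoped NNReal Matrix

namespace HiDetect

/-- Stacked vectors in `ℂ^(us)`: `u` blocks (users) of `s` entries (channel taps) each. -/
abbrev Vec (u s : ℕ) : Type := Fin u × Fin s → ℂ

/-- The Euclidean norm of a complex vector. -/
noncomputable def l2norm {ι : Type*} [Fintype ι] (x : ι → ℂ) : ℝ :=
  ‖WithLp.toLp 2 x‖

/-- The `i`-th block of a stacked vector. -/
def block {u s : ℕ} (x : Vec u s) (i : Fin u) : Fin s → ℂ := fun j => x (i, j)

/-! ### Hierarchical thresholding -/

/-- Hierarchical `(ku, ks)`-sparsity: at most `ku` blocks are non-zero, and every block has at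
most `ks` non-zero entries. -/
def IsHierSparse {u s : ℕ} (ku ks : ℕ) (x : Vec u s) : Prop :=
  {i : Fin u | block x i ≠ 0}.ncard ≤ ku ∧
    ∀ i : Fin u, (Function.support (block x i)).ncard ≤ ks

/-- `y` is a best `(ku, ks)`-sparse approximation of `x` in the Euclidean norm. -/
def IsBestHierApprox {u s : ℕ} (ku ks : ℕ) (x y : Vec u s) : Prop :=
  IsHierSparse ku ks y ∧
    ∀ y' : Vec u s, IsHierSparse ku ks y' → l2norm (x - y) ≤ l2norm (x - y')

/-- `L` is a hierarchical thresholding operator `L_{ku,ks}`: it sends `x` to the support of a best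
`(ku, ks)`-sparse approximation of `x`. The best approximation need not be unique, so `L` also
fixes how ties are broken. -/
def IsThresholdOp {u s : ℕ} (ku ks : ℕ) (L : Vec u s → Set (Fin u × Fin s)) : Prop :=
  ∀ x : Vec u s, ∃ y : Vec u s, IsBestHierApprox ku ks x y ∧ L x = Function.support y

/-- The linear step `h + Aᴴ (y - A h)` of HiHTP and HiIHT. -/
noncomputable def linearStep {u s m : ℕ} (A : Matrix (Fin m) (Fin u × Fin s) ℂ)
    (y : Fin m → ℂ) (h : Vec u s) : Vec u s :=
  h + Aᴴ *ᵥ (y - A *ᵥ h)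

/-- The support estimate of HiHTP and HiIHT in their first iteration, which starts at `0`. -/
noncomputable def firstSupport {u s m : ℕ} (L : Vec u s → Set (Fin u × Fin s))
    (A : Matrix (Fin m) (Fin u × Fin s) ℂ) (y : Fin m → ℂ) : Set (Fin u × Fin s) :=
  L (linearStep A y 0)

/-- The linear estimate restricted to the first support estimate; this is the first HiIHT
iterate. -/
noncomputable def firstEstimate {u s m : ℕ} (L : Vec u s → Set (Fin u × Fin s))
    (A : Matrix (Fin m) (Fin u × Fin s) ℂ) (y : Fin m → ℂ) : Vec u s :=
  (firstSupport L A y).indicator (linearStep A y 0)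

/-- The users with `√ξ ≤ ‖x_i‖`. -/
def energyDetect {u s : ℕ} (ξ : ℝ) (x : Vec u s) : Set (Fin u) :=
  {i | √ξ ≤ l2norm (block x i)}

/-- The detected users: those which are kept by the hierarchical thresholding and whose estimated
block passes the energy test. For `ξ > 0` the second condition implies the first. -/
noncomputable def detectedUsers {u s m : ℕ} (L : Vec u s → Set (Fin u × Fin s))
    (A : Matrix (Fin m) (Fin u × Fin s) ℂ) (y : Fin m → ℂ) (ξ : ℝ) : Set (Fin u) :=
  {i | ∃ j, (i, j) ∈ firstSupport L A y} ∩ energyDetect ξ (firstEstimate L A y)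

/-! ### The measurement matrix -/

/-- The subsampled FFT with rows `b 0, …, b (m - 1)`, normalized by `√(n/m)`. The stacked index
`(i, j)` is the column `i * s + j`. -/
noncomputable def subFFT {n m u s : ℕ} (b : Fin m → Fin n) :
    Matrix (Fin m) (Fin u × Fin s) ℂ :=
  fun k l => ((√((n : ℝ) / m) * (√(n : ℝ))⁻¹ : ℝ) : ℂ) *
    Complex.exp (-(Complex.I * 2 * Real.pi * ((b k : ℕ) : ℂ) *
      (((l.1 : ℕ) * s + (l.2 : ℕ) : ℕ) : ℂ) / (n : ℂ)))

/-! ### The random model -/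

/-- The circularly symmetric complex Gaussian law `CN(0, v)`, `v = 𝔼|x|²`. -/
noncomputable def complexGaussian (v : ℝ≥0) : MeasureTheory.Measure ℂ :=
  ((ProbabilityTheory.gaussianReal 0 (v / 2)).prod
    (ProbabilityTheory.gaussianReal 0 (v / 2))).map (fun p => (⟨p.1, p.2⟩ : ℂ))

/-- The uniform law on the `k`-element subsets of a finite type. -/
noncomputable def uniformSubset (α : Type*) [Fintype α] (k : ℕ) :
    MeasureTheory.Measure (Finset α) :=
  ProbabilityTheory.uniformOn ((Finset.univ.powersetCard k : Finset (Finset α)) : Set (Finset α))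

/-- An outcome: the sampled rows, the set of active users, the tap positions of every user, the
channel coefficients, and the noise per signal dimension. -/
abbrev Outcome (n m u s : ℕ) : Type :=
  (Fin m → Fin n) × Finset (Fin u) × (Fin u → Finset (Fin s)) × Vec u s × Vec u s

namespace Outcome

variable {n m u s : ℕ}

def rows (o : Outcome n m u s) : Fin m → Fin n := o.1
def active (o : Outcome n m u s) : Finset (Fin u) := o.2.1
def taps (o : Outcome n m u s) (i : Fin u) : Finset (Fin s) := o.2.2.1 i
def coeff (o : Outcome n m u s) : Vec u s := o.2.2.2.1
def noise (o : Outcome n m u s) : Vec u s := o.2.2.2.2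

/-- The channel vector `h`: the coefficients on the taps of the active users, and zero elsewhere. -/
def channel (o : Outcome n m u s) : Vec u s :=
  fun l => if l.1 ∈ o.active ∧ l.2 ∈ o.taps l.1 then o.coeff l else 0

/-- The noisy channel vector `h + z'`. -/
def noisyChannel (o : Outcome n m u s) : Vec u s := o.channel + o.noise

noncomputable def matrix (o : Outcome n m u s) : Matrix (Fin m) (Fin u × Fin s) ℂ :=
  subFFT o.rows

/-- The measurement `y = A (h + z')`. -/
noncomputable def measurement (o : Outcome n m u s) : Fin m → ℂ :=
  o.matrix *ᵥ o.noisyChannel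

end Outcome

/-- The law of the model; all ingredients are independent. The rows of the FFT have an arbitrary
law `ν` (for instance, an enumeration of a uniformly random `m`-element set of rows), the active
users are a uniform `ku`-element set, the taps of every user are a uniform `ks`-element set, the
coefficients are `CN(0, 1)` and the noise is `CN(0, σ² m / n²)` in every coordinate. -/
noncomputable def modelLaw {n m u s : ℕ} (ku ks : ℕ) (σ : ℝ) (ν : PMF (Fin m → Fin n)) :
    MeasureTheory.Measure (Outcome n m u s) :=
  ν.toMeasure.prod ((uniformSubset (Fin u) ku).prod
    ((MeasureTheory.Measure.pi fun _ : Fin u => uniformSubset (Fin s) ks).prod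
      ((MeasureTheory.Measure.pi fun _ : Fin u × Fin s => complexGaussian 1).prod
        (MeasureTheory.Measure.pi fun _ : Fin u × Fin s =>
          complexGaussian (Real.toNNReal (σ ^ 2 * m / (n : ℝ) ^ 2))))))

/-- The law of the model, given that user `i` is active. -/
noncomputable def modelLawActive {n m u s : ℕ} (ku ks : ℕ) (σ : ℝ) (ν : PMF (Fin m → Fin n))
    (i : Fin u) : MeasureTheory.Measure (Outcome n m u s) :=
  ProbabilityTheory.cond (modelLaw ku ks σ ν) {o | i ∈ o.active}

/-! ### Figures of merit -/

/-- For an active user `i`, the probability of not being detected. -/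
noncomputable def missedDetectionProb {n m u s : ℕ} (ku ks : ℕ) (σ : ℝ)
    (ν : PMF (Fin m → Fin n)) (L : Vec u s → Set (Fin u × Fin s)) (i : Fin u) (ξ : ℝ) : ℝ :=
  (modelLawActive ku ks σ ν i).real
    {o | i ∉ detectedUsers L o.matrix o.measurement ξ}

/-- The energies of `x` and of its estimate `x'` differ by at most `ε` on every set of `ks`
entries within one block. -/
def EnergyClose {u s : ℕ} (ks : ℕ) (ε : ℝ) (x x' : Vec u s) : Prop :=
  ∀ (i : Fin u) (ω : Finset (Fin s)), ω.card = ks →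
    |∑ j ∈ ω, ‖x (i, j)‖ ^ 2 - ∑ j ∈ ω, ‖x' (i, j)‖ ^ 2| ≤ ε

/-- The probability that the linear estimate `Aᴴ y` fails to reproduce the `ks`-term block energies
of `h + z'` up to `ε`. -/
noncomputable def notSRIPProb {n m u s : ℕ} (ku ks : ℕ) (σ : ℝ)
    (ν : PMF (Fin m → Fin n)) (ε : ℝ) : ℝ :=
  (modelLaw ku ks σ ν).real
    {o : Outcome n m u s | ¬ EnergyClose ks ε o.noisyChannel (o.matrixᴴ *ᵥ o.measurement)}

/-- The distribution function of the energy of `h + z'` on the taps of an active user `i`. -/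
noncomputable def noisyEnergyCDF {n m u s : ℕ} (ku ks : ℕ) (σ : ℝ)
    (ν : PMF (Fin m → Fin n)) (i : Fin u) (x : ℝ) : ℝ :=
  (modelLawActive ku ks σ ν i).real
    {o : Outcome n m u s | ∑ j ∈ o.taps i, ‖o.noisyChannel (i, j)‖ ^ 2 ≤ x}

/-- The signal-to-noise ratio, for channel coefficients of unit power. -/
noncomputable def snr (σ : ℝ) : ℝ := 1 / σ ^ 2

end HiDetect

namespace HiDetect

/-! A best hierarchical approximation cannot be improved by exchanging blocks. So if an active user
`i` is missed, then either its block of `Aᴴ y` has energy at most `ξ` on its taps, or an inactive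
user took its place and has at least that energy on some `ks` entries
(`IsThresholdOp.missed_energy`). When block energies are preserved up to `ε`, this passes to `h +
z'`: unless the tap energy `E` of `i` is at most `ξ + 4ε`, one has `E ≤ N + 2ε` with `2ε < E / 2`,
where `N` is pure noise energy on `ks` entries, so some noise coordinate of an inactive user
satisfies `E ≤ 2 ks |z|²` (`Outcome.missed_imp`).

For one such coordinate, the exponential tail of `|z|²` turns the probability into the Laplace
transform of `E`, and the bounded density of the coefficients bounds that by `(2 ks v)^ks`, with `v`
the noise variance (`pi_prod_complexGaussian_le`). A union bound runs over the `s (u - ku)`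
coordinates of inactive users.

Missed detection is conditional on `i` being active, while the energy distortion is not. The two
agree because `Aᴴ A` commutes with cyclic shifts of the blocks and the model is invariant under
renaming users: the distortion event is equally likely jointly with the activity of each user, hence
independent of it (`modelLawActive_not_energyClose`).

The argument gives the term `F^z` with coefficient 1; the stated coefficient `2 s (u - ku)` is
slack. -/

theorem l2norm_sq {ι : Type*} [Fintype ι] (x : ι → ℂ) : l2norm x ^ 2 = ∑ l, ‖x l‖ ^ 2 := by
  simp [l2norm, EuclideanSpace.norm_sq_eq]

theorem l2norm_nonneg {ι : Type*} [Fintype ι] (x : ι → ℂ) : 0 ≤ l2norm x := norm_nonneg _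

/-! ### Exchange arguments for best hierarchically sparse approximations -/

section BestApprox

variable {u s ku ks : ℕ} {x y : Vec u s}

theorem IsBestHierApprox.sum_le (h : IsBestHierApprox ku ks x y) {y' : Vec u s}
    (hy' : IsHierSparse ku ks y') : ∑ l, ‖x l - y l‖ ^ 2 ≤ ∑ l, ‖x l - y' l‖ ^ 2 := by
  have := pow_le_pow_left₀ (l2norm_nonneg _) (h.2 y' hy') 2
  simpa [l2norm_sq] using this

theorem IsHierSparse.mono {y' : Vec u s} (hy : IsHierSparse ku ks y)
    (h : ∀ l, y l = 0 → y' l = 0) : IsHierSparse ku ks y' := by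
  refine ⟨le_trans (Set.ncard_le_ncard ?_ (Set.toFinite _)) hy.1,
    fun i => le_trans (Set.ncard_le_ncard ?_ (Set.toFinite _)) (hy.2 i)⟩
  · intro i hi h0
    exact hi (funext fun j => h (i, j) (congrFun h0 j))
  · intro j hj h0
    exact hj (h (i, j) h0)

/-- Restoring `x` on the support of `y` preserves sparsity and would strictly lower the error at
`l`. -/
theorem IsBestHierApprox.eq_of_ne_zero (h : IsBestHierApprox ku ks x y) {l : Fin u × Fin s}
    (hl : y l ≠ 0) : y l = x l := by
  by_contra hne
  have hsp : IsHierSparse ku ks (fun l => if y l = 0 then 0 else x l) :=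
    h.1.mono fun l hl => by simp [hl]
  refine absurd (h.sum_le hsp) (not_le.mpr (Finset.sum_lt_sum (fun l _ => ?_)
    ⟨l, Finset.mem_univ _, ?_⟩))
  · by_cases h0 : y l = 0 <;> simp [h0]
  · have : x l - y l ≠ 0 := sub_ne_zero.mpr (Ne.symm hne)
    have hpos : 0 < ‖x l - y l‖ := norm_pos_iff.mpr this
    simp only [hl, if_false, sub_self, norm_zero]
    simpa using pow_pos hpos 2

theorem IsBestHierApprox.indicator_support (h : IsBestHierApprox ku ks x y) :
    (Function.support y).indicator x = y := by
  funext l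
  by_cases hl : y l = 0
  · simp [hl]
  · rw [Set.indicator_of_mem (by exact hl), h.eq_of_ne_zero hl]

theorem IsBestHierApprox.norm_sub_sq (h : IsBestHierApprox ku ks x y) (l : Fin u × Fin s) :
    ‖x l - y l‖ ^ 2 = ‖x l‖ ^ 2 - ‖y l‖ ^ 2 := by
  by_cases hl : y l = 0
  · simp [hl]
  · simp [h.eq_of_ne_zero hl]

/-- Exchanging block `j` of a best approximation for `ks` entries of block `i` gains no energy. -/
theorem IsBestHierApprox.block_energy_le (h : IsBestHierApprox ku ks x y) {i j : Fin u}
    (hij : j = i ∨ block y i = 0)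
    (hcard : block y j ≠ 0 ∨ {i : Fin u | block y i ≠ 0}.ncard < ku)
    {ω : Finset (Fin s)} (hω : ω.card ≤ ks) :
    ∑ k ∈ ω, ‖x (i, k)‖ ^ 2 ≤ ∑ k, ‖y (j, k)‖ ^ 2 := by
  classical
  set N : Set (Fin u) := {i | block y i ≠ 0} with hN
  -- The competitor: block `i` becomes `x` on `ω`, and block `j` is erased unless `j = i`. By
  -- `hcard`, either the erased block or an unused slot pays for block `i`.
  set y' : Vec u s := fun l =>
    if l.1 = i then (if l.2 ∈ ω then x l else 0) else if l.1 = j then 0 else y l with hy'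
  have hsp : IsHierSparse ku ks y' := by
    refine ⟨?_, fun i' => ?_⟩
    · have hsub : {i' : Fin u | block y' i' ≠ 0} ⊆ insert i (N \ {j}) := by
        intro i' hi'
        by_cases h1 : i' = i
        · exact Or.inl h1
        · have h2 : i' ≠ j := by
            rintro rfl
            exact hi' (by funext k; simp [block, hy', h1])
          refine Or.inr ⟨fun h0 => hi' ?_, h2⟩
          funext k
          have := congrFun h0 k
          simpa [block, hy', h1, h2] using this
      refine le_trans (Set.ncard_le_ncard hsub (Set.toFinite _)) ?_
      refine le_trans (Set.ncard_insert_le _ _) ?_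
      rcases hcard with hj | hlt
      · have : (N \ {j}).ncard + 1 = N.ncard := Set.ncard_sdiff_singleton_add_one hj (Set.toFinite _)
        rw [this]
        exact h.1.1
      · have : (N \ {j}).ncard ≤ N.ncard := Set.ncard_le_ncard Set.sdiff_subset (Set.toFinite _)
        omega
    · by_cases h1 : i' = i
      · refine le_trans (Set.ncard_le_ncard (t := (ω : Set (Fin s))) ?_ (Set.toFinite _)) ?_
        · intro k hk
          by_contra hkω
          exact hk (by simp_all [block])
        · rwa [Set.ncard_coe_finset]
      · refine le_trans (Set.ncard_le_ncard ?_ (Set.toFinite _)) (h.1.2 i')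
        intro k hk h0
        refine hk ?_
        have h0' : y (i', k) = 0 := h0
        simp [block, hy', h1, h0']
  have hle := h.sum_le hsp
  -- Erasing block `j` costs its energy, and filling block `i` gains the energy on `ω`. For `i = j`
  -- both corrections fall on the same block.
  have hblock : ∀ i', ∑ k, ‖x (i', k) - y' (i', k)‖ ^ 2 =
      ∑ k, ‖x (i', k) - y (i', k)‖ ^ 2
        + ((if i' = j then ∑ k, ‖y (j, k)‖ ^ 2 else 0)
        - (if i' = i then ∑ k ∈ ω, ‖x (i, k)‖ ^ 2 else 0)) := by
    intro i'
    simp only [h.norm_sub_sq, Finset.sum_sub_distrib]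
    by_cases h1 : i' = i
    · subst h1
      have e1 : ∑ k, ‖x (i', k) - y' (i', k)‖ ^ 2
          = ∑ k, ‖x (i', k)‖ ^ 2 - ∑ k ∈ ω, ‖x (i', k)‖ ^ 2 := by
        have e2 : ∑ k ∈ ω, ‖x (i', k)‖ ^ 2 = ∑ k, if k ∈ ω then ‖x (i', k)‖ ^ 2 else 0 := by simp
        rw [e2, ← Finset.sum_sub_distrib]
        refine Finset.sum_congr rfl fun k _ => ?_
        by_cases hk : k ∈ ω <;> simp [hy', hk]
      rw [e1]
      rcases hij with rfl | h0
      · simp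
      · have : ∀ k, y (i', k) = 0 := fun k => congrFun h0 k
        by_cases h2 : i' = j
        · subst h2; simp [this, sub_eq_add_neg]
        · simp [this, h2, sub_eq_add_neg]
    · by_cases h2 : i' = j
      · subst h2
        simp [hy', h1]
      · simp [hy', h1, h2, h.norm_sub_sq, Finset.sum_sub_distrib]
  rw [Fintype.sum_prod_type, Fintype.sum_prod_type, Finset.sum_congr rfl fun i' _ => hblock i',
    Finset.sum_add_distrib, Finset.sum_sub_distrib] at hle
  simp only [Finset.sum_ite_eq', Finset.mem_univ, if_true] at hle
  linarith

/-- The support of a block is padded to exactly `ks` entries, which is the size that `EnergyClose`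
controls. -/
theorem IsBestHierApprox.exists_energy_le (h : IsBestHierApprox ku ks x y) (hks : ks ≤ s)
    (j : Fin u) : ∃ ω : Finset (Fin s), ω.card = ks ∧
      ∑ k, ‖y (j, k)‖ ^ 2 ≤ ∑ k ∈ ω, ‖x (j, k)‖ ^ 2 := by
  classical
  have hcard : (Finset.univ.filter fun k => y (j, k) ≠ 0).card ≤ ks := by
    rw [← Set.ncard_coe_finset]
    refine le_trans (le_of_eq ?_) (h.1.2 j)
    congr 1
    ext k
    simp [block]
  obtain ⟨ω, hsub, hω⟩ := Finset.exists_superset_card_eq hcard (by simpa using hks)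
  refine ⟨ω, hω, ?_⟩
  rw [← Finset.sum_subset (Finset.subset_univ ω)
    (fun k _ hk => by
      have : y (j, k) = 0 := by
        by_contra h0
        exact hk (hsub (by simp [h0]))
      simp [this])]
  refine Finset.sum_le_sum fun k _ => ?_
  by_cases h0 : y (j, k) = 0
  · simp [h0]
  · rw [h.eq_of_ne_zero h0]

/-- An active user `i` whose block has been discarded, or kept with energy below `ξ`, either has
small energy on every `ks` entries, or loses against an inactive user. -/
theorem IsBestHierApprox.missed_energy (h : IsBestHierApprox ku ks x y) (hks : ks ≤ s)
    {i : Fin u} {ξ : ℝ} (hξ : 0 ≤ ξ) {act : Finset (Fin u)} (hact : act.card = ku) (hi : i ∈ act)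
    (hmiss : block y i = 0 ∨ l2norm (block y i) < √ξ)
    {ω : Finset (Fin s)} (hω : ω.card = ks) :
    ∑ k ∈ ω, ‖x (i, k)‖ ^ 2 ≤ ξ ∨
      ∃ j ∉ act, ∃ ω' : Finset (Fin s), ω'.card = ks ∧
        ∑ k ∈ ω, ‖x (i, k)‖ ^ 2 ≤ ∑ k ∈ ω', ‖x (j, k)‖ ^ 2 := by
  by_cases h0 : block y i = 0
  -- With a free slot, block `i` could be added at no cost, so its energy on `ω` vanishes.
  · by_cases hlt : {i : Fin u | block y i ≠ 0}.ncard < ku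
    · left
      refine le_trans (h.block_energy_le (Or.inl rfl) (Or.inr hlt) hω.le) ?_
      have : ∀ k, y (i, k) = 0 := fun k => congrFun h0 k
      simpa [this] using hξ
    · right
      -- Pigeonhole: at least `ku` blocks are kept and `i` is not among them, so the other `ku - 1`
      -- active users cannot account for all of them.
      have : ∃ j, block y j ≠ 0 ∧ j ∉ act := by
        by_contra! hcon
        have hsub : {i : Fin u | block y i ≠ 0} ⊆ ((act.erase i : Finset (Fin u)) : Set (Fin u)) := by
          intro j hj
          simp only [Finset.coe_erase]
          exact ⟨hcon j hj, fun e => hj (by rw [e]; exact h0)⟩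
        have h1 := Set.ncard_le_ncard hsub (Set.toFinite _)
        rw [Set.ncard_coe_finset, Finset.card_erase_of_mem hi] at h1
        have := Finset.card_pos.mpr ⟨i, hi⟩
        omega
      obtain ⟨j, hj, hja⟩ := this
      obtain ⟨ω', hω', hle⟩ := h.exists_energy_le hks j
      exact ⟨j, hja, ω', hω', (h.block_energy_le (Or.inr h0) (Or.inl hj) hω.le).trans hle⟩
  · left
    have hlt := hmiss.resolve_left h0
    have h2 : l2norm (block y i) ^ 2 < ξ := by
      have := pow_lt_pow_left₀ hlt (l2norm_nonneg _) two_ne_zero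
      rwa [Real.sq_sqrt hξ] at this
    rw [l2norm_sq] at h2
    exact (h.block_energy_le (Or.inl rfl) (Or.inl h0) hω.le).trans h2.le

end BestApprox

theorem linearStep_zero {u s m : ℕ} (A : Matrix (Fin m) (Fin u × Fin s) ℂ) (y : Fin m → ℂ) :
    linearStep A y 0 = Aᴴ *ᵥ y := by
  simp [linearStep]

theorem IsThresholdOp.missed_energy {u s m ku ks : ℕ} {L : Vec u s → Set (Fin u × Fin s)}
    (hL : IsThresholdOp ku ks L) (hks : ks ≤ s) (A : Matrix (Fin m) (Fin u × Fin s) ℂ)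
    (y : Fin m → ℂ) {i : Fin u} {ξ : ℝ} (hξ : 0 ≤ ξ) {act : Finset (Fin u)} (hact : act.card = ku)
    (hi : i ∈ act) (hmiss : i ∉ detectedUsers L A y ξ)
    {ω : Finset (Fin s)} (hω : ω.card = ks) :
    ∑ k ∈ ω, ‖(Aᴴ *ᵥ y) (i, k)‖ ^ 2 ≤ ξ ∨
      ∃ j ∉ act, ∃ ω' : Finset (Fin s), ω'.card = ks ∧
        ∑ k ∈ ω, ‖(Aᴴ *ᵥ y) (i, k)‖ ^ 2 ≤ ∑ k ∈ ω', ‖(Aᴴ *ᵥ y) (j, k)‖ ^ 2 := by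
  obtain ⟨w, hw, hLw⟩ := hL (Aᴴ *ᵥ y)
  refine hw.missed_energy hks hξ hact hi ?_ hω
  have hest : firstEstimate L A y = w := by
    simp only [firstEstimate, firstSupport, linearStep_zero, hLw, hw.indicator_support]
  by_contra! hcon
  refine hmiss ⟨?_, ?_⟩
  · obtain ⟨j, hj⟩ := Function.ne_iff.mp hcon.1
    refine ⟨j, ?_⟩
    rw [firstSupport, linearStep_zero, hLw]
    exact hj
  · rw [energyDetect, Set.mem_ofPred_eq, hest]
    exact hcon.2

/-! ### From a missed user to a large noise coordinate -/

namespace Outcome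

/-- The energy of the noisy channel on the taps of user `i`. -/
noncomputable def tapEnergy {n m u s : ℕ} (o : Outcome n m u s) (i : Fin u) : ℝ :=
  ∑ j ∈ o.taps i, ‖o.noisyChannel (i, j)‖ ^ 2

theorem noisyChannel_of_notMem {n m u s : ℕ} (o : Outcome n m u s) {j : Fin u}
    (hj : j ∉ o.active) (l : Fin s) : o.noisyChannel (j, l) = o.noise (j, l) := by
  simp [noisyChannel, channel, hj]

/-- If the linear estimate preserves the energies, a missed active user has small energy, or less
energy than a multiple of a noise coordinate of an inactive user. -/
theorem missed_imp {n m u s ku ks : ℕ} {L : Vec u s → Set (Fin u × Fin s)}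
    (hL : IsThresholdOp ku ks L) (hks' : ks ≤ s) {i : Fin u} {ξ ε : ℝ}
    (hξ : 0 ≤ ξ) (hε : 0 < ε) {o : Outcome n m u s}
    (hclose : EnergyClose ks ε o.noisyChannel (o.matrixᴴ *ᵥ o.measurement))
    (hact : o.active.card = ku) (htaps : (o.taps i).card = ks) (hi : i ∈ o.active)
    (hmiss : i ∉ detectedUsers L o.matrix o.measurement ξ) :
    o.tapEnergy i ≤ ξ + 4 * ε ∨
      ∃ j ∉ o.active, ∃ l, o.tapEnergy i ≤ 2 * ks * ‖o.noise (j, l)‖ ^ 2 := by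
  by_cases hE : o.tapEnergy i ≤ ξ + 4 * ε
  · exact Or.inl hE
  right
  have h1 := abs_le.mp (hclose i (o.taps i) htaps)
  change _ ≤ o.tapEnergy i - _ ∧ o.tapEnergy i - _ ≤ _ at h1
  rcases hL.missed_energy hks' o.matrix o.measurement hξ hact hi hmiss htaps with h2 | h2
  · linarith [h1.2]
  obtain ⟨j, hj, ω, hω, hle⟩ := h2
  have h3 := abs_le.mp (hclose j ω hω)
  refine ⟨j, hj, ?_⟩
  -- If every coordinate is too small, summing over `ω` bounds the noise energy by half the tap
  -- energy. Two errors of `ε` then force the tap energy to be at most `4 * ε`, contrary to `hE`.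
  by_contra! hcon
  have h4 : ∑ k ∈ ω, 2 * (ks : ℝ) * ‖o.noisyChannel (j, k)‖ ^ 2 ≤ ∑ k ∈ ω, o.tapEnergy i :=
    Finset.sum_le_sum fun k _ => by
      rw [o.noisyChannel_of_notMem hj]
      exact (hcon k).le
  rw [← Finset.mul_sum, Finset.sum_const, hω, nsmul_eq_mul] at h4
  rcases Nat.eq_zero_or_pos ks with h0 | h0
  · rw [h0, Finset.card_eq_zero] at hω
    rw [h0, Finset.card_eq_zero] at htaps
    have : o.tapEnergy i = 0 := by simp [tapEnergy, htaps]
    linarith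
  · have h0' : (0 : ℝ) < ks := by exact_mod_cast h0
    have h5 : 2 * ∑ k ∈ ω, ‖o.noisyChannel (j, k)‖ ^ 2 ≤ o.tapEnergy i :=
      le_of_mul_le_mul_left (by linarith) h0'
    linarith [h1.2, h3.1]

end Outcome

/-! ### Complex Gaussian tails and Laplace transforms -/

section Gaussian

open MeasureTheory ProbabilityTheory Filter Topology

theorem measurable_complex_mk : Measurable fun p : ℝ × ℝ => (⟨p.1, p.2⟩ : ℂ) :=
  Complex.measurableEquivRealProd.symm.measurable

instance (v : ℝ≥0) : IsProbabilityMeasure (complexGaussian v) :=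
  Measure.isProbabilityMeasure_map measurable_complex_mk.aemeasurable

theorem norm_mk_sq (x y : ℝ) : ‖(⟨x, y⟩ : ℂ)‖ ^ 2 = x ^ 2 + y ^ 2 := by
  rw [Complex.sq_norm, Complex.normSq_mk]
  ring

/-- The radial part of the Gaussian tail, with an explicit antiderivative; the factor `1 / (2π)` is
cancelled by the angular integral. -/
theorem lintegral_Ici_mul_exp_neg_sq {v a : ℝ} (hv : 0 < v) (ha : 0 ≤ a) :
    ∫⁻ ρ in Set.Ici a, ENNReal.ofReal (ρ * ((Real.pi * v)⁻¹ * Real.exp (-ρ ^ 2 / v)))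
      ≤ ENNReal.ofReal (Real.exp (-a ^ 2 / v) / (2 * Real.pi)) := by
  set g : ℝ → ℝ := fun ρ => -(Real.exp (-ρ ^ 2 / v) / (2 * Real.pi)) with hg
  set g' : ℝ → ℝ := fun ρ => ρ * ((Real.pi * v)⁻¹ * Real.exp (-ρ ^ 2 / v)) with hg'
  have hderiv : ∀ ρ, HasDerivAt g (g' ρ) ρ := by
    intro ρ
    have h := (((((hasDerivAt_id ρ).pow 2).neg).div_const v).exp.div_const (2 * Real.pi)).neg
    refine h.congr_deriv ?_
    have := Real.pi_pos.ne'
    simp [hg']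
    field_simp
  have hcont : ContinuousWithinAt g (Set.Ici a) a := (hderiv a).continuousAt.continuousWithinAt
  have hnonneg : ∀ ρ ∈ Set.Ioi a, 0 ≤ g' ρ := by
    intro ρ hρ
    have : 0 < ρ := lt_of_le_of_lt ha hρ
    have := Real.pi_pos
    positivity
  have hlim : Tendsto g atTop (𝓝 0) := by
    have h1 : Tendsto (fun ρ : ℝ => ρ ^ 2 / v) atTop atTop :=
      (tendsto_pow_atTop two_ne_zero).atTop_div_const hv
    have h2 := ((Real.tendsto_exp_neg_atTop_nhds_zero.comp h1).div_const (2 * Real.pi)).neg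
    simpa [hg, Function.comp_def, neg_div] using h2
  rw [← setLIntegral_congr Ioi_ae_eq_Ici, ← ofReal_integral_eq_lintegral_ofReal
    (integrableOn_Ioi_deriv_of_nonneg hcont (fun ρ _ => hderiv ρ) hnonneg hlim)
    ((ae_restrict_iff' measurableSet_Ioi).mpr (ae_of_all _ hnonneg)),
    integral_Ioi_of_hasDerivAt_of_nonneg hcont (fun ρ _ => hderiv ρ) hnonneg hlim]
  simp [hg]

theorem gaussianPDF_mul_gaussianPDF {v : ℝ≥0} (x y : ℝ) :
    gaussianPDF 0 (v / 2) x * gaussianPDF 0 (v / 2) y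
      = ENNReal.ofReal ((Real.pi * v)⁻¹ * Real.exp (-(x ^ 2 + y ^ 2) / v)) := by
  rw [gaussianPDF, gaussianPDF, ← ENNReal.ofReal_mul (gaussianPDFReal_nonneg _ _ _)]
  congr 1
  simp only [gaussianPDFReal, NNReal.coe_div, NNReal.coe_ofNat, sub_zero]
  have h1 : (2 * Real.pi * ((v : ℝ) / 2)) = Real.pi * v := by ring
  have h2 : (2 * ((v : ℝ) / 2)) = v := by ring
  rw [h1, h2, mul_mul_mul_comm, ← Real.exp_add, ← mul_inv, Real.mul_self_sqrt (by positivity)]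
  congr 2
  ring

theorem complexGaussian_norm_sq_ge_le {v : ℝ≥0} (hv : v ≠ 0) {r : ℝ} (hr : 0 ≤ r) :
    complexGaussian v {z | r ≤ ‖z‖ ^ 2} ≤ ENNReal.ofReal (Real.exp (-r / v)) := by
  have hv' : (0 : ℝ) < v := by exact_mod_cast pos_iff_ne_zero.mpr hv
  have hm : MeasurableSet {z : ℂ | r ≤ ‖z‖ ^ 2} :=
    measurableSet_le measurable_const (by fun_prop)
  set D : Set (ℝ × ℝ) := {p | r ≤ p.1 ^ 2 + p.2 ^ 2} with hD
  have hDm : MeasurableSet D := measurableSet_le measurable_const (by fun_prop)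
  have hv2 : v / 2 ≠ 0 := by simp [hv]
  have hpre : (fun p : ℝ × ℝ => (⟨p.1, p.2⟩ : ℂ)) ⁻¹' {z : ℂ | r ≤ ‖z‖ ^ 2} = D := by
    ext p
    simp only [Set.mem_preimage, Set.mem_ofPred_eq, norm_mk_sq, hD]
  rw [complexGaussian, Measure.map_apply measurable_complex_mk hm, hpre,
    gaussianReal_of_var_ne_zero _ hv2, prod_withDensity (measurable_gaussianPDF _ _)
    (measurable_gaussianPDF _ _), withDensity_apply _ hDm, ← Measure.volume_eq_prod]
  simp only [gaussianPDF_mul_gaussianPDF]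
  rw [← lintegral_indicator hDm, ← lintegral_comp_polarCoord_symm]
  set G : ℝ → ENNReal := fun ρ => (Set.Ici √r).indicator
    (fun ρ => ENNReal.ofReal (ρ * ((Real.pi * v)⁻¹ * Real.exp (-ρ ^ 2 / v)))) ρ with hG
  have hGm : Measurable G := by
    refine Measurable.indicator ?_ measurableSet_Ici
    fun_prop
  have hle : ∀ p ∈ polarCoord.target, ENNReal.ofReal p.1 • D.indicator (fun p : ℝ × ℝ =>
      ENNReal.ofReal ((Real.pi * v)⁻¹ * Real.exp (-(p.1 ^ 2 + p.2 ^ 2) / v)))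
      (polarCoord.symm p) ≤ G p.1 * 1 := by
    rintro ⟨ρ, θ⟩ hp
    have hρ : 0 < ρ := by
      rw [polarCoord_target] at hp
      exact hp.1
    have hsq : (ρ * Real.cos θ) ^ 2 + (ρ * Real.sin θ) ^ 2 = ρ ^ 2 := by
      linear_combination ρ ^ 2 * Real.cos_sq_add_sin_sq θ
    simp only [polarCoord_symm_apply, mul_one]
    by_cases hmem : (ρ * Real.cos θ, ρ * Real.sin θ) ∈ D
    · have hmem' : ρ ∈ Set.Ici √r := by
        rw [hD, Set.mem_ofPred_eq, hsq] at hmem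
        exact Real.sqrt_le_iff.mpr ⟨hρ.le, hmem⟩
      rw [Set.indicator_of_mem hmem, hG]
      simp only
      rw [Set.indicator_of_mem hmem', hsq, smul_eq_mul, ← ENNReal.ofReal_mul hρ.le]
    · rw [Set.indicator_of_notMem hmem, smul_zero]
      exact zero_le
  calc _ ≤ ∫⁻ p in polarCoord.target, G p.1 * 1 :=
        setLIntegral_mono (by fun_prop) hle
    _ = (∫⁻ ρ in Set.Ioi 0, G ρ) * ∫⁻ _ in Set.Ioo (-Real.pi) Real.pi, 1 := by
        rw [polarCoord_target, Measure.volume_eq_prod, ← Measure.prod_restrict,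
          lintegral_prod_mul hGm.aemeasurable aemeasurable_const]
    _ ≤ (∫⁻ ρ, G ρ) * ENNReal.ofReal (2 * Real.pi) := by
        gcongr
        · exact Measure.restrict_le_self
        · rw [setLIntegral_one, Real.volume_Ioo]
          exact ENNReal.ofReal_le_ofReal (by linarith)
    _ ≤ ENNReal.ofReal (Real.exp (-√r ^ 2 / v) / (2 * Real.pi)) * ENNReal.ofReal (2 * Real.pi) := by
        gcongr
        rw [hG, lintegral_indicator measurableSet_Ici]
        exact lintegral_Ici_mul_exp_neg_sq hv' (Real.sqrt_nonneg r)
    _ = _ := by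
        rw [← ENNReal.ofReal_mul (by positivity), Real.sq_sqrt hr,
          div_mul_cancel₀ _ (by positivity)]

/-- The density is at most `1 / √π`, and Lebesgue measure is translation invariant, so the bound is
uniform in the shift `a`. The shift will be the noise. -/
theorem lintegral_exp_neg_mul_sq_gaussianReal_le {lam : ℝ} (hlam : 0 < lam) (a : ℝ) :
    ∫⁻ x, ENNReal.ofReal (Real.exp (-lam * (x + a) ^ 2)) ∂gaussianReal 0 (1 / 2)
      ≤ ENNReal.ofReal √(1 / lam) := by
  rw [gaussianReal_of_var_ne_zero _ (by norm_num), lintegral_withDensity_eq_lintegral_mul _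
    (measurable_gaussianPDF _ _) (by fun_prop)]
  have hle : ∀ x : ℝ, gaussianPDF 0 (1 / 2) x ≤ ENNReal.ofReal (√Real.pi)⁻¹ := by
    intro x
    refine ENNReal.ofReal_le_ofReal ?_
    simp only [gaussianPDFReal, NNReal.coe_div, NNReal.coe_ofNat, NNReal.coe_one, sub_zero]
    rw [show 2 * Real.pi * (1 / 2) = Real.pi by ring]
    refine mul_le_of_le_one_right (by positivity) (Real.exp_le_one_iff.mpr ?_)
    have := sq_nonneg x
    norm_num
    exact this
  calc _ ≤ ∫⁻ x, ENNReal.ofReal (√Real.pi)⁻¹ * ENNReal.ofReal (Real.exp (-lam * (x + a) ^ 2)) :=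
        lintegral_mono fun x => by
          simp only [Pi.mul_apply]
          gcongr
          exact hle x
    _ = ENNReal.ofReal (√Real.pi)⁻¹ * ENNReal.ofReal √(Real.pi / lam) := by
        rw [lintegral_const_mul _ (by fun_prop),
          lintegral_add_right_eq_self (fun x => ENNReal.ofReal (Real.exp (-lam * x ^ 2))) a,
          ← ofReal_integral_eq_lintegral_ofReal (integrable_exp_neg_mul_sq hlam)
            (ae_of_all _ fun x => (Real.exp_pos _).le), integral_gaussian]
    _ = _ := by
        rw [← ENNReal.ofReal_mul (by positivity), Real.sqrt_div Real.pi_pos.le,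
          Real.sqrt_div zero_le_one, Real.sqrt_one, ← mul_div_assoc, inv_mul_cancel₀ (by positivity)]

theorem lintegral_exp_neg_norm_add_sq_le {lam : ℝ} (hlam : 0 < lam) (w : ℂ) :
    ∫⁻ c, ENNReal.ofReal (Real.exp (-lam * ‖c + w‖ ^ 2)) ∂complexGaussian 1
      ≤ ENNReal.ofReal (1 / lam) := by
  rw [complexGaussian, lintegral_map (by fun_prop) measurable_complex_mk]
  have heq : ∀ p : ℝ × ℝ, ENNReal.ofReal (Real.exp (-lam * ‖(⟨p.1, p.2⟩ : ℂ) + w‖ ^ 2)) =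
      ENNReal.ofReal (Real.exp (-lam * (p.1 + w.re) ^ 2)) *
        ENNReal.ofReal (Real.exp (-lam * (p.2 + w.im) ^ 2)) := by
    intro p
    rw [← ENNReal.ofReal_mul (Real.exp_pos _).le, ← Real.exp_add, ← mul_add, ← norm_mk_sq]
    rfl
  simp only [heq]
  rw [lintegral_prod_mul (f := fun x => ENNReal.ofReal (Real.exp (-lam * (x + w.re) ^ 2)))
    (g := fun x => ENNReal.ofReal (Real.exp (-lam * (x + w.im) ^ 2))) (by fun_prop) (by fun_prop)]
  refine (mul_le_mul' (lintegral_exp_neg_mul_sq_gaussianReal_le hlam _)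
    (lintegral_exp_neg_mul_sq_gaussianReal_le hlam _)).trans (le_of_eq ?_)
  rw [← ENNReal.ofReal_mul (by positivity), Real.mul_self_sqrt (by positivity)]

section Pi

variable {ι : Type*} [Fintype ι]

/-- Integrate over `z l` alone: the sum over `T` does not involve it, so it is a constant threshold
in the exponential tail of `‖z l‖ ^ 2`. -/
theorem pi_complexGaussian_le_lintegral_exp {v : ℝ≥0} (hv : v ≠ 0) {κ : ℝ} (hκ : 0 < κ)
    (T : Finset ι) {l : ι} (hl : l ∉ T) (c : ι → ℂ) :
    Measure.pi (fun _ : ι => complexGaussian v)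
        {z | ∑ t ∈ T, ‖c t + z t‖ ^ 2 ≤ κ * ‖z l‖ ^ 2}
      ≤ ∫⁻ z, ENNReal.ofReal (Real.exp (-(1 / (κ * v)) * ∑ t ∈ T, ‖c t + z t‖ ^ 2))
          ∂Measure.pi (fun _ : ι => complexGaussian v) := by
  classical
  have hm : MeasurableSet {z : ι → ℂ | ∑ t ∈ T, ‖c t + z t‖ ^ 2 ≤ κ * ‖z l‖ ^ 2} :=
    measurableSet_le (by fun_prop) (by fun_prop)
  rw [← lintegral_indicator_one hm]
  refine lintegral_le_of_lmarginal_le {l} (measurable_one.indicator hm) (by fun_prop) ?_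
  intro z
  rw [lmarginal_singleton, lmarginal_singleton]
  have hQ : ∀ w : ℂ, ∑ t ∈ T, ‖c t + Function.update z l w t‖ ^ 2 = ∑ t ∈ T, ‖c t + z t‖ ^ 2 :=
    fun w => Finset.sum_congr rfl fun t ht => by
      have hne : t ≠ l := fun h => hl (h ▸ ht)
      rw [Function.update_of_ne hne]
  simp only [hQ, lintegral_const, measure_univ, mul_one]
  set Q := ∑ t ∈ T, ‖c t + z t‖ ^ 2 with hQdef
  have hQ0 : 0 ≤ Q := Finset.sum_nonneg fun _ _ => by positivity
  calc _ = ∫⁻ w, Set.indicator {w : ℂ | Q / κ ≤ ‖w‖ ^ 2} 1 w ∂complexGaussian v := by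
        refine lintegral_congr fun w => ?_
        simp only [Set.indicator_apply, Set.mem_ofPred_eq, hQ, Function.update_self,
          div_le_iff₀' hκ, Pi.one_apply]
    _ = complexGaussian v {w | Q / κ ≤ ‖w‖ ^ 2} :=
        lintegral_indicator_one (measurableSet_le measurable_const (by fun_prop))
    _ ≤ _ := complexGaussian_norm_sq_ge_le hv (div_nonneg hQ0 hκ.le)
    _ = _ := by
        congr 2
        field_simp

theorem lintegral_pi_exp_neg_sum_le {lam : ℝ} (hlam : 0 < lam) (T : Finset ι) (z : ι → ℂ) :
    ∫⁻ c, ENNReal.ofReal (Real.exp (-lam * ∑ t ∈ T, ‖c t + z t‖ ^ 2))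
        ∂Measure.pi (fun _ : ι => complexGaussian 1)
      ≤ ENNReal.ofReal ((1 / lam) ^ T.card) := by
  have heq : ∀ c : ι → ℂ, ENNReal.ofReal (Real.exp (-lam * ∑ t ∈ T, ‖c t + z t‖ ^ 2)) =
      ∏ t ∈ T, ENNReal.ofReal (Real.exp (-lam * ‖c t + z t‖ ^ 2)) := by
    intro c
    rw [← ENNReal.ofReal_prod_of_nonneg fun _ _ => (Real.exp_pos _).le, ← Real.exp_sum,
      Finset.mul_sum]
  simp only [heq]
  have hind : iIndepFun (fun t (c : ι → ℂ) => ENNReal.ofReal (Real.exp (-lam * ‖c t + z t‖ ^ 2)))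
      (Measure.pi fun _ : ι => complexGaussian 1) :=
    iIndepFun_pi (X := fun t (w : ℂ) => ENNReal.ofReal (Real.exp (-lam * ‖w + z t‖ ^ 2)))
      fun t => by fun_prop
  rw [lintegral_prod_eq_prod_lintegral_of_indepFun T _ hind fun t => by fun_prop,
    ENNReal.ofReal_pow (by positivity)]
  refine Finset.prod_le_pow_card _ _ _ fun t _ => ?_
  refine le_trans (le_of_eq ?_) (lintegral_exp_neg_norm_add_sq_le hlam (z t))
  exact (measurePreserving_eval (fun _ : ι => complexGaussian 1) t).lintegral_comp
    (f := fun w => ENNReal.ofReal (Real.exp (-lam * ‖w + z t‖ ^ 2))) (by fun_prop)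

/-- The energy of a noisy Gaussian vector on `T` is below `κ` times the energy of a noise
coordinate outside `T` with probability at most `(κ v) ^ |T|`. -/
theorem pi_prod_complexGaussian_le {v : ℝ≥0} (hv : v ≠ 0) {κ : ℝ} (hκ : 0 < κ)
    (T : Finset ι) {l : ι} (hl : l ∉ T) :
    (Measure.pi (fun _ : ι => complexGaussian 1)).prod (Measure.pi fun _ : ι => complexGaussian v)
        {p | ∑ t ∈ T, ‖p.1 t + p.2 t‖ ^ 2 ≤ κ * ‖p.2 l‖ ^ 2}
      ≤ ENNReal.ofReal ((κ * v) ^ T.card) := by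
  have hv' : (0 : ℝ) < v := by exact_mod_cast pos_iff_ne_zero.mpr hv
  rw [Measure.prod_apply (measurableSet_le (by fun_prop) (by fun_prop))]
  refine (lintegral_mono fun c => pi_complexGaussian_le_lintegral_exp hv hκ T hl c).trans ?_
  -- Integrating over the coefficients first, with the noise fixed, gives a bound independent of the
  -- noise.
  rw [lintegral_lintegral_swap (by fun_prop)]
  refine (lintegral_mono fun z => lintegral_pi_exp_neg_sum_le (by positivity) T z).trans ?_
  simp

end Pi

end Gaussian

open MeasureTheory ProbabilityTheory

/-! ### Shift equivariance of the subsampled FFT -/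

section FFT

/-- Shifting the block index multiplies row `k` by a phase independent of the column. Wrapping
around modulo `u` is harmless because `n = u * s` is a period of the exponential. -/
theorem subFFT_add {n m u s : ℕ} [NeZero u] (hn : n = u * s) (b : Fin m → Fin n) (c : Fin u)
    (k : Fin m) (l : Fin u × Fin s) :
    subFFT b k (l.1 + c, l.2) = subFFT b k l *
      Complex.exp (((-(2 * Real.pi * (b k : ℕ) * ((c : ℕ) * s : ℕ) / n) : ℝ) : ℂ) * Complex.I) := by
  have hn0 : (n : ℂ) ≠ 0 := Nat.cast_ne_zero.mpr (b k).pos.ne'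
  obtain ⟨q, hmod⟩ : ∃ q : ℕ, (((l.1 + c : Fin u) : ℕ) : ℂ) = l.1 + c - u * q := by
    refine ⟨((l.1 : ℕ) + c) / u, ?_⟩
    rw [Fin.val_add, eq_sub_iff_add_eq]
    exact_mod_cast Nat.mod_add_div _ _
  have hnC : (n : ℂ) = u * s := by exact_mod_cast hn
  simp only [subFFT]
  rw [mul_assoc (Complex.ofReal _), ← Complex.exp_add]
  congr 1
  rw [Complex.exp_eq_exp_iff_exists_int]
  refine ⟨((b k : ℕ) * q : ℕ), ?_⟩
  push_cast
  rw [hmod]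
  field_simp
  rw [hnC]
  ring

/-- The Gram matrix of a subsampled FFT commutes with cyclic shifts of the blocks. -/
theorem subFFT_gram_shift {n m u s : ℕ} [NeZero u] (hn : n = u * s) (b : Fin m → Fin n)
    (c : Fin u) (x : Vec u s) (l : Fin u × Fin s) :
    ((subFFT b)ᴴ *ᵥ (subFFT b *ᵥ fun l' : Fin u × Fin s => x (l'.1 + c, l'.2))) l =
      ((subFFT b)ᴴ *ᵥ (subFFT b *ᵥ x)) (l.1 + c, l.2) := by
  simp only [Matrix.mulVec, dotProduct, Matrix.conjTranspose_apply]
  refine Finset.sum_congr rfl fun k _ => ?_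
  set w : ℂ := Complex.exp
    (((-(2 * Real.pi * (b k : ℕ) * ((c : ℕ) * s : ℕ) / n) : ℝ) : ℂ) * Complex.I) with hw
  have hnorm : star w * w = 1 := by
    have h1 : ‖w‖ = 1 := Complex.norm_exp_ofReal_mul_I _
    have h2 := Complex.conj_mul' w
    rw [h1] at h2
    simpa using h2
  have hsum : ∑ l', subFFT b k l' * x l' =
      w * ∑ l' : Fin u × Fin s, subFFT b k l' * x (l'.1 + c, l'.2) := by
    rw [← Equiv.sum_comp ((Equiv.addRight c).prodCongr (Equiv.refl (Fin s))), Finset.mul_sum]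
    refine Finset.sum_congr rfl fun l' _ => ?_
    simp only [Equiv.prodCongr_apply, Equiv.coe_addRight, Equiv.coe_refl, Prod.map, id]
    rw [subFFT_add hn b c k l']
    ring
  rw [hsum, subFFT_add hn b c k l, star_mul']
  linear_combination (-(star (subFFT b k l) *
    ∑ l' : Fin u × Fin s, subFFT b k l' * x (l'.1 + c, l'.2))) * hnorm

end FFT

/-! ### Uniform subsets and relabelling of users -/

section UniformSubset

instance (α : Type*) [Fintype α] (k : ℕ) : IsFiniteMeasure (uniformSubset α k) := by
  unfold uniformSubset uniformOn
  infer_instance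

theorem isProbabilityMeasure_uniformSubset {α : Type*} [Fintype α] {k : ℕ}
    (hk : k ≤ Fintype.card α) : IsProbabilityMeasure (uniformSubset α k) := by
  refine isProbabilityMeasure_uniformOn (Set.toFinite _) ?_
  rw [Finset.coe_nonempty]
  exact Finset.powersetCard_nonempty.mpr (by simpa using hk)

theorem ae_uniformSubset_card {α : Type*} [Fintype α] (k : ℕ) :
    ∀ᵐ A ∂uniformSubset α k, A.card = k := by
  have h : ∀ᵐ A ∂uniformSubset α k,
      A ∈ ((Finset.univ.powersetCard k : Finset (Finset α)) : Set (Finset α)) :=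
    ae_cond_mem (Set.toFinite _).measurableSet
  filter_upwards [h] with A hA
  simpa using hA

theorem measurePreserving_uniformSubset_map {α : Type*} [Fintype α] (k : ℕ) (e : Equiv.Perm α) :
    MeasurePreserving (fun A : Finset α => A.map e.toEmbedding) (uniformSubset α k)
      (uniformSubset α k) := by
  have hmeas : Measurable fun A : Finset α => A.map e.toEmbedding := measurable_of_finite _
  refine ⟨hmeas, Measure.ext fun t ht => ?_⟩
  rw [Measure.map_apply hmeas ht, uniformSubset, uniformOn,
    cond_apply (Set.toFinite _).measurableSet, cond_apply (Set.toFinite _).measurableSet]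
  congr 1
  set S : Set (Finset α) := ((Finset.univ.powersetCard k : Finset (Finset α)) : Set (Finset α))
  have hinj : Function.Injective fun A : Finset α => A.map e.toEmbedding :=
    Finset.map_injective _
  rw [← Measure.count_injective_image hinj (S ∩ _)]
  congr 1
  ext A
  constructor
  · rintro ⟨B, ⟨hB, hBt⟩, rfl⟩
    exact ⟨by simpa [S] using hB, hBt⟩
  · rintro ⟨hA, hAt⟩
    have hAe : (A.map e.symm.toEmbedding).map e.toEmbedding = A := by
      ext; simp
    exact ⟨A.map e.symm.toEmbedding, ⟨by simpa [S] using hA, by simpa [hAe] using hAt⟩, hAe⟩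

end UniformSubset

theorem measurePreserving_pi_comp {ι X : Type*} [Fintype ι] [MeasurableSpace X] (μ : Measure X)
    [SigmaFinite μ] (e : Equiv.Perm ι) :
    MeasurePreserving (fun x : ι → X => x ∘ e) (Measure.pi fun _ : ι => μ)
      (Measure.pi fun _ : ι => μ) := by
  have := measurePreserving_arrowCongr' (fun _ : ι => μ) (fun _ : ι => μ) e.symm
    (MeasurableEquiv.refl X) (fun _ => MeasurePreserving.id μ)
  exact this

/-- A random set of `k` elements meets `E` in the mean `k` times. -/
theorem sum_measure_mem_inter {Ω α : Type*} [MeasurableSpace Ω] [Fintype α] {μ : Measure Ω} {k : ℕ}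
    {A : Ω → Finset α} (hA : Measurable A) (hcard : ∀ᵐ o ∂μ, (A o).card = k) (E : Set Ω) :
    ∑ i, μ ({o | i ∈ A o} ∩ E) = k * μ E := by
  classical
  have hm : ∀ i, MeasurableSet {o | i ∈ A o} := fun i =>
    hA (Set.toFinite {B : Finset α | i ∈ B}).measurableSet
  calc ∑ i, μ ({o | i ∈ A o} ∩ E)
      = ∑ i, ∫⁻ o, {o | i ∈ A o}.indicator 1 o ∂μ.restrict E :=
        Finset.sum_congr rfl fun i _ => by
          rw [lintegral_indicator_one (hm i), Measure.restrict_apply (hm i)]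
    _ = ∫⁻ o, ∑ i, {o | i ∈ A o}.indicator 1 o ∂μ.restrict E :=
        (lintegral_finsetSum _ fun i _ => measurable_one.indicator (hm i)).symm
    _ = ∫⁻ _, (k : ENNReal) ∂μ.restrict E := by
        refine lintegral_congr_ae ?_
        filter_upwards [ae_restrict_of_ae hcard] with o ho
        simp [Set.indicator_apply, ho]
    _ = k * μ E := by simp

namespace Outcome

variable {n m u s : ℕ}

theorem measurable_active : Measurable (active : Outcome n m u s → Finset (Fin u)) :=
  measurable_fst.comp measurable_snd

/-- Renaming the users. -/
def relabel (e : Equiv.Perm (Fin u)) (o : Outcome n m u s) : Outcome n m u s :=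
  (o.1, o.2.1.map e.symm.toEmbedding, o.2.2.1 ∘ e,
    o.2.2.2.1 ∘ e.prodCongr (Equiv.refl _), o.2.2.2.2 ∘ e.prodCongr (Equiv.refl _))

theorem mem_active_relabel (e : Equiv.Perm (Fin u)) (o : Outcome n m u s) (i : Fin u) :
    i ∈ (o.relabel e).active ↔ e i ∈ o.active := by
  change i ∈ o.2.1.map e.symm.toEmbedding ↔ e i ∈ o.2.1
  simp [Finset.mem_map_equiv]

theorem noisyChannel_relabel (e : Equiv.Perm (Fin u)) (o : Outcome n m u s) :
    (o.relabel e).noisyChannel = fun l => o.noisyChannel (e l.1, l.2) := by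
  funext l
  simp only [noisyChannel, channel, Pi.add_apply, mem_active_relabel]
  rfl

/-- Relabelling leaves the sampled rows fixed, so equivariance must come from the Gram matrix; this
is why only cyclic shifts are used. -/
theorem gram_relabel_add [NeZero u] (hn : n = u * s) (c : Fin u) (o : Outcome n m u s) :
    ((o.relabel (Equiv.addRight c)).matrixᴴ *ᵥ (o.relabel (Equiv.addRight c)).measurement) =
      fun l => (o.matrixᴴ *ᵥ o.measurement) (l.1 + c, l.2) := by
  funext l
  simp only [measurement, noisyChannel_relabel]
  exact subFFT_gram_shift hn o.rows c o.noisyChannel l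

theorem measurePreserving_relabel (ku ks : ℕ) (σ : ℝ) (ν : PMF (Fin m → Fin n))
    (e : Equiv.Perm (Fin u)) :
    MeasurePreserving (relabel (s := s) e) (modelLaw ku ks σ ν) (modelLaw ku ks σ ν) :=
  (MeasurePreserving.id _).prod ((measurePreserving_uniformSubset_map ku e.symm).prod
    ((measurePreserving_pi_comp _ e).prod ((measurePreserving_pi_comp _ _).prod
      (measurePreserving_pi_comp _ _))))

end Outcome

theorem energyClose_comp {u s ks : ℕ} {ε : ℝ} (e : Equiv.Perm (Fin u)) (x x' : Vec u s) :
    EnergyClose ks ε (fun l => x (e l.1, l.2)) (fun l => x' (e l.1, l.2)) ↔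
      EnergyClose ks ε x x' := by
  unfold EnergyClose
  exact e.forall_congr fun _ => Iff.rfl

open MeasureTheory ProbabilityTheory

/-! ### Conditioning on activity and the union bound -/

section ModelLaw

variable {n m u s ku ks : ℕ} {σ : ℝ} {ν : PMF (Fin m → Fin n)}

theorem isProbabilityMeasure_modelLaw (hku : ku ≤ u) (hks : ks ≤ s) :
    IsProbabilityMeasure (modelLaw (u := u) (s := s) ku ks σ ν) := by
  have := isProbabilityMeasure_uniformSubset (α := Fin u) (by simpa using hku)
  have := isProbabilityMeasure_uniformSubset (α := Fin s) (by simpa using hks)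
  unfold modelLaw
  infer_instance

theorem ae_card_active : ∀ᵐ o ∂modelLaw (u := u) (s := s) ku ks σ ν, o.active.card = ku :=
  Measure.quasiMeasurePreserving_snd.ae
    (Measure.quasiMeasurePreserving_fst.ae (ae_uniformSubset_card ku))

theorem ae_card_taps (i : Fin u) :
    ∀ᵐ o ∂modelLaw (u := u) (s := s) ku ks σ ν, (o.taps i).card = ks :=
  Measure.quasiMeasurePreserving_snd.ae (Measure.quasiMeasurePreserving_snd.ae
    (Measure.quasiMeasurePreserving_fst.ae ((Measure.quasiMeasurePreserving_eval
      (μ := fun _ : Fin u => uniformSubset (Fin s) ks) i).ae (ae_uniformSubset_card ks))))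

theorem measurableSet_mem_active (i : Fin u) :
    MeasurableSet {o : Outcome n m u s | i ∈ o.active} :=
  Outcome.measurable_active (Set.toFinite {B : Finset (Fin u) | i ∈ B}).measurableSet

/-- An event which is invariant under cyclic shifts of the users is equally likely together with
each of the users being active. -/
theorem mul_measure_active_inter [NeZero u] {E : Set (Outcome n m u s)}
    (hE : ∀ (c : Fin u) (o : Outcome n m u s), o.relabel (Equiv.addRight c) ∈ E ↔ o ∈ E)
    (i : Fin u) :
    u * modelLaw ku ks σ ν ({o | i ∈ o.active} ∩ E) = ku * modelLaw ku ks σ ν E := by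
  have hle : ∀ i j : Fin u, modelLaw ku ks σ ν ({o | i ∈ o.active} ∩ E) ≤
      modelLaw ku ks σ ν ({o | j ∈ o.active} ∩ E) := by
    intro i j
    have hT := Outcome.measurePreserving_relabel (s := s) ku ks σ ν (Equiv.addRight (i - j))
    calc _ = modelLaw ku ks σ ν (Outcome.relabel (Equiv.addRight (i - j)) ⁻¹'
          ({o | j ∈ o.active} ∩ E)) := by
          congr 1
          ext o
          simp only [Set.mem_inter_iff, Set.mem_preimage, Set.mem_ofPred_eq,
            Outcome.mem_active_relabel, hE, Equiv.coe_addRight, add_sub_cancel]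
      -- Since `E` is not assumed measurable, only this inequality is used; exchanging `i` and `j`
      -- gives the reverse one.
      _ ≤ (modelLaw ku ks σ ν).map (Outcome.relabel (Equiv.addRight (i - j)))
          ({o | j ∈ o.active} ∩ E) := Measure.le_map_apply hT.measurable.aemeasurable _
      _ = _ := by rw [hT.map_eq]
  rw [← sum_measure_mem_inter Outcome.measurable_active ae_card_active E,
    Finset.sum_congr rfl fun j _ => le_antisymm (hle j i) (hle i j)]
  simp

theorem mul_measure_active [NeZero u] (hku : ku ≤ u) (hks : ks ≤ s) (i : Fin u) :
    u * modelLaw ku ks σ ν {o : Outcome n m u s | i ∈ o.active} = ku := by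
  have := isProbabilityMeasure_modelLaw (n := n) (m := m) (σ := σ) (ν := ν) hku hks
  have h := mul_measure_active_inter (ku := ku) (ks := ks) (σ := σ) (ν := ν) (s := s)
    (E := Set.univ) (fun _ _ => by simp) i
  simpa using h

theorem measure_active_ne_zero [NeZero u] (hku : 0 < ku) (hku' : ku ≤ u) (hks : ks ≤ s)
    (i : Fin u) : modelLaw ku ks σ ν {o : Outcome n m u s | i ∈ o.active} ≠ 0 := by
  intro h
  have := mul_measure_active (σ := σ) (ν := ν) hku' hks i
  rw [h, mul_zero] at this
  exact hku.ne (by exact_mod_cast this)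

/-- Conditioning on the activity of a user does not change the probability that the energies are
distorted. -/
theorem modelLawActive_not_energyClose (hn : n = u * s) (hku : 0 < ku) (hku' : ku ≤ u)
    (hks : ks ≤ s) (i : Fin u) (ε : ℝ) :
    (modelLawActive ku ks σ ν i).real {o : Outcome n m u s |
      ¬ EnergyClose ks ε o.noisyChannel (o.matrixᴴ *ᵥ o.measurement)} =
    notSRIPProb (u := u) (s := s) ku ks σ ν ε := by
  have : NeZero u := ⟨by omega⟩
  have := isProbabilityMeasure_modelLaw (n := n) (m := m) (σ := σ) (ν := ν) hku' hks
  set E : Set (Outcome n m u s) := {o : Outcome n m u s |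
      ¬ EnergyClose ks ε o.noisyChannel (o.matrixᴴ *ᵥ o.measurement)} with hE
  have hinv : ∀ (c : Fin u) (o : Outcome n m u s), o.relabel (Equiv.addRight c) ∈ E ↔ o ∈ E := by
    intro c o
    rw [hE, Set.mem_ofPred_eq, Set.mem_ofPred_eq, Outcome.gram_relabel_add hn,
      Outcome.noisyChannel_relabel]
    exact not_congr (energyClose_comp (Equiv.addRight c) _ _)
  rw [notSRIPProb, Measure.real, Measure.real]
  congr 1
  rw [modelLawActive, cond_apply (measurableSet_mem_active i)]
  have h0 := measure_active_ne_zero (σ := σ) (ν := ν) hku hku' hks i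
  have hu : (u : ENNReal) ≠ 0 := by exact_mod_cast NeZero.ne u
  -- Independence: after multiplication by `u`, both sides equal `ku` times the probability of `E`.
  have h : modelLaw ku ks σ ν ({o | i ∈ o.active} ∩ E) =
      modelLaw ku ks σ ν {o : Outcome n m u s | i ∈ o.active} * modelLaw ku ks σ ν E := by
    rw [← ENNReal.mul_right_inj hu (ENNReal.natCast_ne_top u), mul_measure_active_inter hinv i,
      ← mul_assoc, mul_measure_active hku' hks]
  rw [h, ← mul_assoc, ENNReal.inv_mul_cancel h0 (measure_ne_top _ _), one_mul]

/-- For fixed taps this is the Gaussian estimate with `κ = 2 * ks`; the coordinate `(j, l)` avoids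
the taps of `i` since `j ≠ i`. -/
theorem measure_tapEnergy_le (hks : 0 < ks) (hks' : ks ≤ s) {v : ℝ≥0} (hv : v ≠ 0) {i j : Fin u}
    (hij : j ≠ i) (l : Fin s) :
    (Measure.pi fun _ : Fin u => uniformSubset (Fin s) ks).prod
      ((Measure.pi fun _ : Fin u × Fin s => complexGaussian 1).prod
        (Measure.pi fun _ : Fin u × Fin s => complexGaussian v))
      {q | ∑ t ∈ q.1 i, ‖q.2.1 (i, t) + q.2.2 (i, t)‖ ^ 2 ≤ 2 * ks * ‖q.2.2 (j, l)‖ ^ 2}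
      ≤ ENNReal.ofReal ((2 * ks * v) ^ ks) := by
  classical
  have := isProbabilityMeasure_uniformSubset (α := Fin s) (by simpa using hks')
  have hks0 : (0 : ℝ) < ks := by exact_mod_cast hks
  have hm : MeasurableSet {q : (Fin u → Finset (Fin s)) × Vec u s × Vec u s |
      ∑ t ∈ q.1 i, ‖q.2.1 (i, t) + q.2.2 (i, t)‖ ^ 2 ≤ 2 * ks * ‖q.2.2 (j, l)‖ ^ 2} := by
    refine measurableSet_le ?_ (by fun_prop)
    have : (fun q : (Fin u → Finset (Fin s)) × Vec u s × Vec u s =>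
        ∑ t ∈ q.1 i, ‖q.2.1 (i, t) + q.2.2 (i, t)‖ ^ 2) = fun q =>
        ∑ t, if t ∈ q.1 i then ‖q.2.1 (i, t) + q.2.2 (i, t)‖ ^ 2 else 0 := by
      funext q
      simp
    rw [this]
    refine Finset.measurable_sum _ fun t _ => Measurable.ite ?_ (by fun_prop) measurable_const
    exact measurable_fst (Set.toFinite {B : Fin u → Finset (Fin s) | t ∈ B i}).measurableSet
  rw [Measure.prod_apply hm]
  have hae : ∀ᵐ B ∂Measure.pi fun _ : Fin u => uniformSubset (Fin s) ks, (B i).card = ks :=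
    (Measure.quasiMeasurePreserving_eval
      (μ := fun _ : Fin u => uniformSubset (Fin s) ks) i).ae (ae_uniformSubset_card ks)
  refine (lintegral_mono_ae (g := fun _ => ENNReal.ofReal ((2 * ks * v) ^ ks)) ?_).trans (by simp)
  filter_upwards [hae] with B hB
  have hT := pi_prod_complexGaussian_le hv (κ := 2 * ks) (by positivity)
    ((B i).map ⟨fun t => (i, t), Prod.mk_right_injective i⟩) (l := (j, l))
    (by simp [Ne.symm hij])
  simpa [hB] using hT

/-- The inactive users are random, so the union bound runs over all `j` and keeps the event that `j`
is inactive. Almost surely exactly `u - ku` of these events occur, which restores the factor `u -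
ku`. -/
theorem measure_active_inter_noise_le (hks : 0 < ks) (hks' : ks ≤ s)
    (hv : Real.toNNReal (σ ^ 2 * m / (n : ℝ) ^ 2) ≠ 0) (i : Fin u) :
    modelLaw ku ks σ ν ({o : Outcome n m u s | i ∈ o.active} ∩
        {o | ∃ j ∉ o.active, ∃ l, o.tapEnergy i ≤ 2 * ks * ‖o.noise (j, l)‖ ^ 2}) ≤
      ENNReal.ofReal ((2 * ks * Real.toNNReal (σ ^ 2 * m / (n : ℝ) ^ 2)) ^ ks) *
        (s * (u - ku : ℕ)) * modelLaw ku ks σ ν {o : Outcome n m u s | i ∈ o.active} := by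
  classical
  set v := Real.toNNReal (σ ^ 2 * m / (n : ℝ) ^ 2) with hvdef
  set C := ENNReal.ofReal ((2 * ks * v) ^ ks) with hC
  set μ := modelLaw (u := u) (s := s) ku ks σ ν with hμ
  have := isProbabilityMeasure_uniformSubset (α := Fin s) (by simpa using hks')
  have hterm : ∀ j l, μ {o : Outcome n m u s | (i ∈ o.active ∧ j ∉ o.active) ∧
      o.tapEnergy i ≤ 2 * ks * ‖o.noise (j, l)‖ ^ 2} ≤
      C * μ ({o | j ∈ o.activeᶜ} ∩ {o | i ∈ o.active}) := by
    intro j l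
    by_cases hij : j = i
    · subst hij
      have : {o : Outcome n m u s | (j ∈ o.active ∧ j ∉ o.active) ∧
          o.tapEnergy j ≤ 2 * ks * ‖o.noise (j, l)‖ ^ 2} = ∅ := by
        ext o
        simp
      rw [this, measure_empty]
      exact zero_le
    · set U : Set (Finset (Fin u)) := {A | i ∈ A ∧ j ∉ A} with hU
      set Q : Set ((Fin u → Finset (Fin s)) × Vec u s × Vec u s) :=
        {q | ∑ t ∈ q.1 i, ‖q.2.1 (i, t) + q.2.2 (i, t)‖ ^ 2 ≤ 2 * ks * ‖q.2.2 (j, l)‖ ^ 2} with hQ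
      -- Once `i` is active, its tap energy no longer depends on the active set, so the event lies
      -- in a product set and independence applies.
      have h1 : {o : Outcome n m u s | (i ∈ o.active ∧ j ∉ o.active) ∧
          o.tapEnergy i ≤ 2 * ks * ‖o.noise (j, l)‖ ^ 2} ⊆ Set.univ ×ˢ (U ×ˢ Q) := by
        rintro o ⟨ho, hle⟩
        refine ⟨trivial, ho, ?_⟩
        rw [hQ, Set.mem_ofPred_eq]
        refine le_trans (le_of_eq ?_) hle
        refine Finset.sum_congr rfl fun t ht => ?_
        have ht' : t ∈ o.taps i := ht
        simp only [Outcome.noisyChannel, Outcome.channel, Pi.add_apply, ho.1, ht', and_self,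
          if_true]
        rfl
      have h2 : ({o | j ∈ o.activeᶜ} ∩ {o | i ∈ o.active} : Set (Outcome n m u s)) =
          Set.univ ×ˢ (U ×ˢ Set.univ) := by
        ext o
        simp only [Set.mem_inter_iff, Set.mem_ofPred_eq, Finset.mem_compl, Set.mem_prod,
          Set.mem_univ, true_and, and_true, hU]
        exact and_comm
      refine (measure_mono h1).trans ?_
      rw [h2, hμ, modelLaw, Measure.prod_prod, Measure.prod_prod, Measure.prod_prod,
        Measure.prod_prod, measure_univ, measure_univ, one_mul, one_mul, mul_one, mul_comm]
      gcongr
      exact measure_tapEnergy_le hks hks' hv hij l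
  have hsub : ({o : Outcome n m u s | i ∈ o.active} ∩
        {o | ∃ j ∉ o.active, ∃ l, o.tapEnergy i ≤ 2 * ks * ‖o.noise (j, l)‖ ^ 2}) ⊆
      ⋃ j, ⋃ l, {o : Outcome n m u s | (i ∈ o.active ∧ j ∉ o.active) ∧
        o.tapEnergy i ≤ 2 * ks * ‖o.noise (j, l)‖ ^ 2} := by
    rintro o ⟨hi, j, hj, l, hle⟩
    exact Set.mem_iUnion₂.mpr ⟨j, l, ⟨hi, hj⟩, hle⟩
  have hcard : ∀ᵐ o ∂μ, (o.activeᶜ).card = u - ku := by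
    filter_upwards [ae_card_active (n := n) (m := m) (u := u) (s := s) (ku := ku) (ks := ks)
      (σ := σ) (ν := ν)] with o ho
    rw [Finset.card_compl, ho, Fintype.card_fin]
  have hmeas : Measurable fun o : Outcome n m u s => o.activeᶜ :=
    (measurable_of_finite (compl : Finset (Fin u) → Finset (Fin u))).comp Outcome.measurable_active
  calc _ ≤ ∑ j, ∑ l : Fin s, μ {o : Outcome n m u s | (i ∈ o.active ∧ j ∉ o.active) ∧
        o.tapEnergy i ≤ 2 * ks * ‖o.noise (j, l)‖ ^ 2} :=
        (measure_mono hsub).trans ((measure_iUnion_fintype_le _ _).trans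
          (Finset.sum_le_sum fun j _ => measure_iUnion_fintype_le _ _))
    _ ≤ ∑ j, ∑ _l : Fin s, C * μ ({o | j ∈ o.activeᶜ} ∩ {o | i ∈ o.active}) :=
        Finset.sum_le_sum fun j _ => Finset.sum_le_sum fun l _ => hterm j l
    _ = s * (C * ∑ j, μ ({o | j ∈ o.activeᶜ} ∩ {o | i ∈ o.active})) := by
        simp [Finset.mul_sum]
    _ = _ := by
        rw [sum_measure_mem_inter hmeas hcard]
        ring

theorem modelLawActive_noise_le (hku : 0 < ku) (hku' : ku ≤ u) (hks : 0 < ks) (hks' : ks ≤ s)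
    (hv : 0 < σ ^ 2 * m / (n : ℝ) ^ 2) (i : Fin u) :
    (modelLawActive ku ks σ ν i).real {o : Outcome n m u s |
        ∃ j ∉ o.active, ∃ l, o.tapEnergy i ≤ 2 * ks * ‖o.noise (j, l)‖ ^ 2} ≤
      (2 * ks * (σ ^ 2 * m / (n : ℝ) ^ 2)) ^ ks * (s * ((u : ℝ) - ku)) := by
  have : NeZero u := ⟨by omega⟩
  have := isProbabilityMeasure_modelLaw (n := n) (m := m) (σ := σ) (ν := ν) hku' hks'
  have h0 := measure_active_ne_zero (σ := σ) (ν := ν) hku hku' hks' i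
  have h := measure_active_inter_noise_le (ku := ku) (ν := ν) (n := n) (m := m) (σ := σ) hks hks'
    (by simpa using hv) i
  rw [Real.coe_toNNReal _ hv.le] at h
  have hu : (0 : ℝ) ≤ (u : ℝ) - ku := sub_nonneg.mpr (by exact_mod_cast hku')
  refine ENNReal.toReal_le_of_le_ofReal (by positivity) ?_
  rw [modelLawActive, cond_apply (measurableSet_mem_active i)]
  refine (mul_le_mul_right h _).trans (le_of_eq ?_)
  rw [mul_comm, mul_assoc, ENNReal.mul_inv_cancel h0 (measure_ne_top _ _), mul_one,
    ENNReal.ofReal_mul (by positivity), ENNReal.ofReal_mul (by positivity),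
    ← Nat.cast_sub hku', ENNReal.ofReal_natCast, ENNReal.ofReal_natCast]

end ModelLaw

end HiDetect

/-! ### Assembly of the bound -/

open MeasureTheory ProbabilityTheory HiDetect

theorem theorem4 {n m u s ku ks : ℕ} (hn : n = u * s) (hm : 0 < m)
    (hku : 0 < ku) (hku' : ku < u) (hks : 0 < ks) (hks' : ks ≤ s)
    (σ : ℝ) (hσ : 0 < σ) (ν : PMF (Fin m → Fin n))
    (L : HiDetect.Vec u s → Set (Fin u × Fin s)) (hL : HiDetect.IsThresholdOp ku ks L)
    (i : Fin u) (ξ ε : ℝ) (hξ : 0 ≤ ξ) (hε : 0 < ε) :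
    HiDetect.missedDetectionProb ku ks σ ν L i ξ ≤
      HiDetect.notSRIPProb (u := u) (s := s) ku ks σ ν ε
      + 2 * (s : ℝ) * ((u : ℝ) - (ku : ℝ)) *
          HiDetect.noisyEnergyCDF (s := s) ku ks σ ν i (ξ + 4 * ε)
      + (n : ℝ) ^ (-(ks : ℤ)) * HiDetect.snr σ ^ (-(ks : ℤ)) *
          ((u : ℝ) * (s : ℝ) / (2 * (ks : ℝ) * (m : ℝ))) ^ (-(ks : ℤ)) *
          ((s : ℝ) * ((u : ℝ) - (ku : ℝ))) := by
  have hs : 0 < s := hks.trans_le hks'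
  have hn0 : (0 : ℝ) < n := by
    rw [hn]
    exact_mod_cast Nat.mul_pos (hku.trans hku') hs
  have hm0 : (0 : ℝ) < m := by exact_mod_cast hm
  have hks0 : (0 : ℝ) < ks := by exact_mod_cast hks
  have hs1 : (1 : ℝ) ≤ s := by exact_mod_cast hs
  have hu1 : (1 : ℝ) ≤ (u : ℝ) - ku := by
    have : ((ku + 1 : ℕ) : ℝ) ≤ u := by exact_mod_cast hku'
    push_cast at this
    linarith
  have : NeZero u := ⟨by omega⟩
  have := isProbabilityMeasure_modelLaw (n := n) (m := m) (σ := σ) (ν := ν) hku'.le hks'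
  have h0 := measure_active_ne_zero (σ := σ) (ν := ν) hku hku'.le hks' i
  have : IsProbabilityMeasure (modelLawActive (s := s) ku ks σ ν i) :=
    cond_isProbabilityMeasure h0
  set P := modelLawActive (s := s) ku ks σ ν i with hP
  have hac : P ≪ modelLaw ku ks σ ν := cond_absolutelyContinuous
  set S₁ : Set (Outcome n m u s) :=
    {o | ¬ EnergyClose ks ε o.noisyChannel (o.matrixᴴ *ᵥ o.measurement)}
  set S₂ : Set (Outcome n m u s) := {o | o.tapEnergy i ≤ ξ + 4 * ε}
  set S₃ : Set (Outcome n m u s) := {o |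
    ∃ j ∉ o.active, ∃ l, o.tapEnergy i ≤ 2 * ks * ‖o.noise (j, l)‖ ^ 2}
  -- The tie-breaking in `L` is arbitrary, so the missed event need not be measurable; monotonicity
  -- and subadditivity suffice.
  have hsub : {o : Outcome n m u s | i ∉ detectedUsers L o.matrix o.measurement ξ}
      ≤ᵐ[P] ((S₁ ∪ S₂) ∪ S₃ : Set (Outcome n m u s)) := by
    filter_upwards [hac.ae_le ae_card_active, hac.ae_le (ae_card_taps i),
      ae_cond_mem (measurableSet_mem_active i)] with o hact htaps hi hmiss
    by_cases hclose : EnergyClose ks ε o.noisyChannel (o.matrixᴴ *ᵥ o.measurement)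
    · rcases Outcome.missed_imp hL hks' hξ hε hclose hact htaps hi hmiss with h | h
      · exact Or.inl (Or.inr h)
      · exact Or.inr h
    · exact Or.inl (Or.inl hclose)
  have h1 : P.real S₁ = notSRIPProb (u := u) (s := s) ku ks σ ν ε :=
    modelLawActive_not_energyClose hn hku hku'.le hks' i ε
  have h2 : P.real S₂ = noisyEnergyCDF (s := s) ku ks σ ν i (ξ + 4 * ε) := rfl
  have h3 := modelLawActive_noise_le (ν := ν) (n := n) (m := m) (σ := σ) hku hku'.le hks hks'
    (by positivity) i
  have hle : missedDetectionProb ku ks σ ν L i ξ ≤ P.real S₁ + P.real S₂ + P.real S₃ := by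
    refine (ENNReal.toReal_mono (measure_ne_top _ _) (measure_mono_ae hsub)).trans ?_
    refine (measureReal_union_le _ _).trans ?_
    gcongr
    exact measureReal_union_le _ _
  -- The coefficient is at least 1 because `1 ≤ s` and `ku < u`.
  have hF : P.real S₂ ≤ 2 * (s : ℝ) * ((u : ℝ) - ku) * P.real S₂ := by
    refine le_mul_of_one_le_left measureReal_nonneg ?_
    nlinarith
  have hconst : (n : ℝ) ^ (-(ks : ℤ)) * snr σ ^ (-(ks : ℤ)) *
      ((u : ℝ) * (s : ℝ) / (2 * (ks : ℝ) * (m : ℝ))) ^ (-(ks : ℤ)) =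
      (2 * ks * (σ ^ 2 * m / (n : ℝ) ^ 2)) ^ ks := by
    have hus : (u : ℝ) * s = n := by exact_mod_cast hn.symm
    rw [hus, ← mul_zpow, ← mul_zpow, zpow_neg, zpow_natCast, ← inv_pow, snr]
    congr 1
    field_simp
  rw [hconst, ← h1, ← h2]
  linarith
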